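/- An ellipse with semi-axes $a\ge b>0$ has eccentricity $\sqrt{1-b^2/a^2}$ (circles are ellipses of eccentricity $0$). An ellipse is circumscribed about a convex quadrilateral $R$ if it passes through the four vertices, and inscribed in $R$ if it lies in $R$ and is tangent to its four sides. A convex quadrilateral $R$ is bielliptic of class $\tau$ if it has a unique inscribed ellipse $E_I$ of minimal eccentricity and a unique circumscribed ellipse $E_O$ of minimal eccentricity, and both $E_I$ and $E_O$ have eccentricity $\tau$. It is bicentric if it has both an inscribed and a circumscribed circle. A trapezoid is a convex quadrilateral with exactly one pair of parallel opposite sides. **Theorem 5.** There exists a trapezoid that is bielliptic of class $\tau$ for some $\tau$ with $0<\tau<1$; in particular there is a bielliptic trapezoid that is not bicentric. Moreover, let $t>0$, $t\neq 1$, and let $R_t$ be the trapezoid with vertices $(0,0),(1,0),(0,1),(1,t)$. (i) There is a unique ellipse of minimal eccentricity circumscribed about $R_t$, and the square of its eccentricity is $$\frac{2|t-1|}{\sqrt{(t-1)^2+4}+|t-1|}.$$ (ii) The polynomial $c(k)=16k^3-12(t+1)k^2+4(2t-1)k+t+1$ has a unique root $k_0$ in the open interval with endpoints $\tfrac12$ and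 $\tfrac t2$; there is a unique ellipse of minimal eccentricity inscribed in $R_t$, and the square of its eccentricity is $$\frac{2}{1+\sqrt{1-16\,t\,E(k_0)}},\qquad E(k)=\frac{(2k-1)(2k-t)}{16(t-1)^2k^4+(8+8t^2+48t)k^2-32t(1+t)k+17t^2-2t+1}.$$ -/

import Mathlib

noncomputable section

/-- The Euclidean plane. -/
abbrev Plane := EuclideanSpace ℝ (Fin 2)

/-- The set `S` is an ellipse (as a curve) with semi-major axis of length `a` and semi-minor axis
of length `b`: in the orthonormal frame `u`, `v` centred at `c` it is `X² / a² + Y² / b² = 1`.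
Circles are the case `a = b`. -/
def IsEllipseWithSemiAxes (S : Set Plane) (a b : ℝ) : Prop :=
  0 < b ∧ b ≤ a ∧ ∃ c u v : Plane, ‖u‖ = 1 ∧ ‖v‖ = 1 ∧ inner ℝ u v = 0 ∧
    S = {p | (inner ℝ u (p - c)) ^ 2 / a ^ 2 + (inner ℝ v (p - c)) ^ 2 / b ^ 2 = 1}

/-- `S` is an ellipse of eccentricity `e = √(1 - b² / a²)`. -/
def IsEllipseOfEccentricity (S : Set Plane) (e : ℝ) : Prop :=
  ∃ a b : ℝ, IsEllipseWithSemiAxes S a b ∧ e = √(1 - b ^ 2 / a ^ 2)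

/-- The determinant of two plane vectors. -/
def cross (v w : Plane) : ℝ := v 0 * w 1 - v 1 * w 0

/-- `V 0, V 1, V 2, V 3` are, in this cyclic order, the vertices of a (nondegenerate) convex
quadrilateral: walking around the boundary one turns strictly to the same side at every vertex.
(The index arithmetic is modulo 4.) -/
def IsConvexQuadrilateral (V : Fin 4 → Plane) : Prop :=
  (∀ i, 0 < cross (V (i + 1) - V i) (V (i + 2) - V (i + 1))) ∨
  (∀ i, cross (V (i + 1) - V i) (V (i + 2) - V (i + 1)) < 0)

/-- A trapezoid: a convex quadrilateral with exactly one pair of parallel opposite sides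
(so parallelograms are excluded). -/
def IsTrapezoid (V : Fin 4 → Plane) : Prop :=
  IsConvexQuadrilateral V ∧
    Xor (cross (V 1 - V 0) (V 3 - V 2) = 0) (cross (V 2 - V 1) (V 0 - V 3) = 0)

/-- The curve `S` is circumscribed about the quadrilateral: it passes through all vertices. -/
def CircumscribedAbout (V : Fin 4 → Plane) (S : Set Plane) : Prop :=
  ∀ i, V i ∈ S

/-- The curve `S` (an ellipse in all uses) is inscribed in the quadrilateral: it lies in the closed
region bounded by it and is tangent to each of the four sides, that is, it meets the line through
the side in exactly one point, and this point belongs to the side. -/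
def InscribedIn (V : Fin 4 → Plane) (S : Set Plane) : Prop :=
  S ⊆ convexHull ℝ (Set.range V) ∧
    ∀ i, ∃ q ∈ segment ℝ (V i) (V (i + 1)),
      S ∩ (affineSpan ℝ {V i, V (i + 1)} : Set Plane) = {q}

/-- `S` is the unique ellipse of minimal eccentricity among the ellipses with property `P`,
and its eccentricity is `e`. -/
def IsUniqueEllipseOfMinEccentricity (P : Set Plane → Prop) (S : Set Plane) (e : ℝ) : Prop :=
  P S ∧ IsEllipseOfEccentricity S e ∧
    ∀ S' e', P S' → IsEllipseOfEccentricity S' e' → e ≤ e' ∧ (e' = e → S' = S)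

/-- A convex quadrilateral is bielliptic of class `τ` if its inscribed ellipse `E_I` of minimal
eccentricity and its circumscribed ellipse `E_O` of minimal eccentricity both have
eccentricity `τ`. -/
def IsBiellipticOfClass (V : Fin 4 → Plane) (τ : ℝ) : Prop :=
  IsConvexQuadrilateral V ∧ ∃ E_I E_O : Set Plane,
    IsUniqueEllipseOfMinEccentricity (InscribedIn V) E_I τ ∧
    IsUniqueEllipseOfMinEccentricity (CircumscribedAbout V) E_O τ

/-- A convex quadrilateral is bicentric if it has an inscribed and a circumscribed circle. -/
def IsBicentric (V : Fin 4 → Plane) : Prop :=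
  IsConvexQuadrilateral V ∧
    (∃ (c : Plane) (r : ℝ), 0 < r ∧ InscribedIn V (Metric.sphere c r)) ∧
    (∃ (c : Plane) (r : ℝ), 0 < r ∧ CircumscribedAbout V (Metric.sphere c r))

/-- The quadrilateral with vertices `(0,0), (1,0), (1,t), (0,1)`, in cyclic order. -/
def trap (t : ℝ) : Fin 4 → Plane :=
  ![!₂[0, 0], !₂[1, 0], !₂[1, t], !₂[0, 1]]

/-- The cubic whose root is the ordinate of the centre of the optimal inscribed ellipse. -/
def cubicC (t k : ℝ) : ℝ :=
  16 * k ^ 3 - 12 * (t + 1) * k ^ 2 + 4 * (2 * t - 1) * k + t + 1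

/-- The rational function that enters the minimal inscribed eccentricity. -/
def ratioE (t k : ℝ) : ℝ :=
  (2 * k - 1) * (2 * k - t) /
    (16 * (t - 1) ^ 2 * k ^ 4 + (8 + 8 * t ^ 2 + 48 * t) * k ^ 2 - 32 * t * (1 + t) * k
      + 17 * t ^ 2 - 2 * t + 1)

end

/-!
The eccentricity of an ellipse `A x² + 2 B x y + C y² = κ` is a strictly decreasing function
`eccOfRatio` of `ρ = (A C - B²) / (A + C)²`, so that minimal eccentricity means maximal `ρ`. The
circumscribed and the inscribed ellipses of a trapezoid each form a one-parameter family, and on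
both of them `ρ` is an explicit rational function of the parameter.

The computation is made for all trapezoids with vertices `(0, 0)`, `(w, s)`, `(w, s + t)`, `(0, 1)`,
in the affine frame `(w, s), (0, 1)` in which they become `trap t`; only the trace of the form
depends on `w` and `s`.

* Passing through the vertices forces the form `A x² - (t - 1) C x y + C y²`. Comparing `ρ` with its
  claimed maximum leaves a perfect square, which vanishes for a single value of `A / C`
  (`exists_min_circumscribed`).
* A line is tangent to an ellipse when the inverse form at its normal equals the squared offset
  from the centre. The four tangency equations leave the family `inEllipse`, indexed by the fraction
  `z ∈ (0, 1)` of the side `x = 1` at which the ellipse touches it; the ordinate of the centre is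
  `k = (1 + (t - 1) z) / 2`. So a strict maximiser of `ρ` in this family is all that is needed
  (`exists_min_inscribed`).
* For `trap t` the ratio is continuous on `[0, 1]`, vanishes at the end points and is positive
  inside. A maximiser is therefore a critical point, that is, a root of `cubicC t`, and the cubic has
  only one root in the interval (`cubicC_root_unique`), so the maximiser is unique.

For the first claim, shearing and stretching the frame gives enough freedom: for
`t = 7`, `s = -9 / 4`, `w² = 171 / 16` both maxima of `ρ` equal `19 / 80`
(`isBiellipticOfClass_trapW`). Since the circumscribed ellipse of minimal eccentricity is not a
circle, no circle is circumscribed about this trapezoid.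
-/

/-! ### Ellipses as quadratic equations -/

/-- The eccentricity of an ellipse as a function of the ratio `det / trace²` of a quadratic form
defining it (or, equivalently, of the inverse form). -/
noncomputable def eccOfRatio (ρ : ℝ) : ℝ := √(2 * √(1 - 4 * ρ) / (1 + √(1 - 4 * ρ)))

lemma eccOfRatio_strictAnti {ρ ρ' : ℝ} (h : ρ < ρ') (h' : ρ' ≤ 1 / 4) :
    eccOfRatio ρ' < eccOfRatio ρ := by
  have h1 : √(1 - 4 * ρ') < √(1 - 4 * ρ) := Real.sqrt_lt_sqrt (by linarith) (by linarith)
  have h0 : 0 ≤ √(1 - 4 * ρ') := Real.sqrt_nonneg _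
  unfold eccOfRatio
  apply Real.sqrt_lt_sqrt (by positivity)
  rw [div_lt_div_iff₀ (by positivity) (by positivity)]
  nlinarith

lemma plane_inner (v w : Plane) : inner ℝ v w = v 0 * w 0 + v 1 * w 1 := by
  simp [PiLp.inner_apply, Fin.sum_univ_two]
  ring

lemma plane_norm_eq_one {v : Plane} : ‖v‖ = 1 ↔ v 0 ^ 2 + v 1 ^ 2 = 1 := by
  rw [EuclideanSpace.norm_eq, Real.sqrt_eq_one, Fin.sum_univ_two]
  simp

/-- Every symmetric pair `(A - C, 2B)` has polar coordinates with the angle doubled; the half angle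
gives the principal axes of the form `A X² + 2 B X Y + C Y²`. -/
lemma exists_principal_angle (A B C : ℝ) : ∃ θ : ℝ,
    A - C = √((A - C) ^ 2 + 4 * B ^ 2) * (Real.cos θ ^ 2 - Real.sin θ ^ 2) ∧
    B = √((A - C) ^ 2 + 4 * B ^ 2) * (Real.sin θ * Real.cos θ) := by
  set z : ℂ := ⟨A - C, 2 * B⟩ with hz
  have hn : ‖z‖ = √((A - C) ^ 2 + 4 * B ^ 2) := by
    rw [Complex.norm_def, Complex.normSq_apply]
    congr 1
    simp [hz]; ring
  refine ⟨z.arg / 2, ?_, ?_⟩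
  · rw [← Real.cos_two_mul', ← hn, mul_div_cancel₀ _ two_ne_zero, Complex.norm_mul_cos_arg]
  · have h := Complex.norm_mul_sin_arg z
    have h2 := Real.sin_two_mul (z.arg / 2)
    rw [mul_div_cancel₀ _ two_ne_zero] at h2
    rw [h2, hn] at h
    have : z.im = 2 * B := rfl
    rw [this] at h
    linarith

/-- A positive definite quadratic equation defines an ellipse, and its eccentricity depends only on
the ratio `det / trace²` of the form. -/
lemma isEllipse_of_form {A B C κ : ℝ} (hA : 0 < A) (hD : 0 < A * C - B ^ 2) (hκ : 0 < κ)
    (a b : ℝ) :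
    IsEllipseOfEccentricity
      {P : Plane | A * (P 0 - a) ^ 2 + 2 * B * (P 0 - a) * (P 1 - b) + C * (P 1 - b) ^ 2 = κ}
      (eccOfRatio ((A * C - B ^ 2) / (A + C) ^ 2)) := by
  have hC : 0 < C := by
    by_contra hC
    nlinarith [mul_nonneg hA.le (neg_nonneg.2 (not_lt.1 hC)), sq_nonneg B]
  obtain ⟨θ, h1, h2⟩ := exists_principal_angle A B C
  set s := √((A - C) ^ 2 + 4 * B ^ 2) with hs
  have hs0 : 0 ≤ s := Real.sqrt_nonneg _
  have hs2 : s ^ 2 = (A - C) ^ 2 + 4 * B ^ 2 := Real.sq_sqrt (by positivity)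
  have hsT : s < A + C := by
    apply lt_of_pow_lt_pow_left₀ 2 (by positivity)
    nlinarith
  have hcs := Real.sin_sq_add_cos_sq θ
  set c := Real.cos θ
  set n := Real.sin θ
  have hm : 0 < A + C - s := by linarith
  have hp : 0 < A + C + s := by linarith
  -- `(A + C ± s) / 2` are the eigenvalues of the form; the smaller one belongs to the major axis
  refine ⟨√(2 * κ / (A + C - s)), √(2 * κ / (A + C + s)), ⟨?_, ?_, !₂[a, b], !₂[-n, c], !₂[c, n],
    ?_, ?_, ?_, ?_⟩, ?_⟩
  · positivity
  · apply Real.sqrt_le_sqrt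
    gcongr
    linarith
  · rw [plane_norm_eq_one]; simp; linarith
  · rw [plane_norm_eq_one]; simp; linarith
  · rw [plane_inner]; simp; ring
  · ext P
    simp only [Set.mem_ofPred_eq, plane_inner]
    rw [Real.sq_sqrt (by positivity), Real.sq_sqrt (by positivity)]
    simp only [PiLp.sub_apply, Matrix.cons_val_zero, Matrix.cons_val_one]
    have hA' : A = (A + C) / 2 * (n ^ 2 + c ^ 2) + s * (c ^ 2 - n ^ 2) / 2 := by
      rw [hcs]; linarith
    have hC' : C = (A + C) / 2 * (n ^ 2 + c ^ 2) - s * (c ^ 2 - n ^ 2) / 2 := by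
      rw [hcs]; linarith
    generalize P 0 - a = X
    generalize P 1 - b = Y
    have key : A * X ^ 2 + 2 * B * X * Y + C * Y ^ 2 =
        (A + C - s) / 2 * (-n * X + c * Y) ^ 2 + (A + C + s) / 2 * (c * X + n * Y) ^ 2 := by
      linear_combination X ^ 2 * hA' + Y ^ 2 * hC' + 2 * X * Y * h2
    rw [key]
    constructor
    · intro h
      field_simp
      linarith
    · intro h
      field_simp at h
      linarith
  · have h3 : 1 - 4 * ((A * C - B ^ 2) / (A + C) ^ 2) = (s / (A + C)) ^ 2 := by
      have : A + C ≠ 0 := by positivity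
      field_simp
      linarith
    unfold eccOfRatio
    rw [h3, Real.sqrt_sq (by positivity), Real.sq_sqrt (by positivity), Real.sq_sqrt (by positivity)]
    congr 1
    field_simp
    ring

/-- Every ellipse is the solution set of a positive definite quadratic equation, here normalised so
that the constant term is the determinant of the form. -/
lemma exists_form_of_isEllipse {S : Set Plane} {e : ℝ} (h : IsEllipseOfEccentricity S e) :
    ∃ A B C a b : ℝ, 0 < A ∧ 0 < C ∧ 0 < A * C - B ^ 2 ∧
      S = {P : Plane | A * (P 0 - a) ^ 2 + 2 * B * (P 0 - a) * (P 1 - b) + C * (P 1 - b) ^ 2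
        = A * C - B ^ 2} ∧
      e = eccOfRatio ((A * C - B ^ 2) / (A + C) ^ 2) := by
  obtain ⟨a, b, ⟨hb, hba, c, u, v, hu, hv, huv, rfl⟩, rfl⟩ := h
  rw [plane_norm_eq_one] at hu hv
  rw [plane_inner] at huv
  have ha : 0 < a := hb.trans_le hba
  -- `v` is `u` rotated by a right angle, up to the sign `δ`
  set δ := u 0 * v 1 - u 1 * v 0 with hδ
  have hdet : δ ^ 2 = 1 := by
    linear_combination hu * (v 0 ^ 2 + v 1 ^ 2) + hv - (u 0 * v 0 + u 1 * v 1) * huv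
  have hv0 : v 0 = -δ * u 1 := by linear_combination (-v 0) * hu + u 0 * huv
  have hv1 : v 1 = δ * u 0 := by linear_combination (-v 1) * hu + u 1 * huv
  clear_value δ
  have hA : b ^ 2 * u 0 ^ 2 + a ^ 2 * v 0 ^ 2 = b ^ 2 * u 0 ^ 2 + a ^ 2 * u 1 ^ 2 := by
    rw [hv0]; linear_combination a ^ 2 * u 1 ^ 2 * hdet
  have hC : b ^ 2 * u 1 ^ 2 + a ^ 2 * v 1 ^ 2 = b ^ 2 * u 1 ^ 2 + a ^ 2 * u 0 ^ 2 := by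
    rw [hv1]; linear_combination a ^ 2 * u 0 ^ 2 * hdet
  have hB : b ^ 2 * (u 0 * u 1) + a ^ 2 * (v 0 * v 1) = (b ^ 2 - a ^ 2) * (u 0 * u 1) := by
    rw [hv0, hv1]; linear_combination -a ^ 2 * u 0 * u 1 * hdet
  have hD : (b ^ 2 * u 0 ^ 2 + a ^ 2 * u 1 ^ 2) * (b ^ 2 * u 1 ^ 2 + a ^ 2 * u 0 ^ 2)
      - ((b ^ 2 - a ^ 2) * (u 0 * u 1)) ^ 2 = a ^ 2 * b ^ 2 := by
    linear_combination a ^ 2 * b ^ 2 * (u 0 ^ 2 + u 1 ^ 2 + 1) * hu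
  have hT : (b ^ 2 * u 0 ^ 2 + a ^ 2 * u 1 ^ 2) + (b ^ 2 * u 1 ^ 2 + a ^ 2 * u 0 ^ 2)
      = a ^ 2 + b ^ 2 := by
    linear_combination (a ^ 2 + b ^ 2) * hu
  have hpos : ∀ x y : ℝ, x ^ 2 + y ^ 2 = 1 → 0 < b ^ 2 * x ^ 2 + a ^ 2 * y ^ 2 := by
    intro x y hxy
    have : b ^ 2 ≤ a ^ 2 := by gcongr
    nlinarith [pow_pos hb 2, mul_nonneg (sub_nonneg.2 this) (sq_nonneg y)]
  refine ⟨_, (b ^ 2 - a ^ 2) * (u 0 * u 1), _, c 0, c 1, hpos _ _ hu, hpos (u 1) (u 0)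
    (by linarith), ?_, ?_, ?_⟩
  · rw [hD]; positivity
  · rw [hD, ← hA, ← hB, ← hC]
    ext P
    simp only [Set.mem_ofPred_eq, plane_inner, PiLp.sub_apply]
    rw [div_add_div _ _ (by positivity) (by positivity), div_eq_one_iff_eq (by positivity)]
    constructor <;> intro h <;> linear_combination h
  · rw [hD, hT]
    have h3 : 1 - 4 * (a ^ 2 * b ^ 2 / (a ^ 2 + b ^ 2) ^ 2)
        = ((a ^ 2 - b ^ 2) / (a ^ 2 + b ^ 2)) ^ 2 := by
      field_simp
      ring
    have h4 : 0 ≤ a ^ 2 - b ^ 2 := sub_nonneg.2 (by gcongr)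
    unfold eccOfRatio
    rw [h3, Real.sqrt_sq (by positivity)]
    congr 1
    field_simp
    ring

/-! ### Conics in an affine frame -/

/-- The affine frame in which the trapezoid `trapW t w s` becomes `trap t`: the point with
coordinates `x, y` with respect to the vectors `(w, s)` and `(0, 1)`. -/
noncomputable def framePoint (w s x y : ℝ) : Plane := !₂[w * x, s * x + y]

/-- The first coordinate of a point in the frame `(w, s), (0, 1)`. -/
noncomputable def frameX (w : ℝ) (P : Plane) : ℝ := P 0 / w

/-- The second coordinate of a point in the frame `(w, s), (0, 1)`. -/
noncomputable def frameY (w s : ℝ) (P : Plane) : ℝ := P 1 - s * (P 0 / w)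

/-- The conic `A (x - a)² + 2 B (x - a) (y - b) + C (y - b)² = κ` in the frame `(w, s), (0, 1)`. -/
def frameConic (w s A B C κ a b : ℝ) : Set Plane :=
  {P | A * (frameX w P - a) ^ 2 + 2 * B * (frameX w P - a) * (frameY w s P - b)
    + C * (frameY w s P - b) ^ 2 = κ}

/-- The ratio `det / trace²` of the form `A x² + 2 B x y + C y²` given in the frame
`(w, s), (0, 1)`, expressed with respect to an orthonormal basis. -/
noncomputable def frameRatio (w s A B C : ℝ) : ℝ :=
  w ^ 2 * (A * C - B ^ 2) / (A - 2 * B * s + C * (s ^ 2 + w ^ 2)) ^ 2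

section Frame

variable {w s : ℝ}

lemma frameX_framePoint (hw : w ≠ 0) (x y : ℝ) : frameX w (framePoint w s x y) = x := by
  simp [frameX, framePoint, hw]

lemma frameY_framePoint (hw : w ≠ 0) (x y : ℝ) : frameY w s (framePoint w s x y) = y := by
  simp [frameY, framePoint, hw]

lemma framePoint_frameX_frameY (hw : w ≠ 0) (P : Plane) :
    framePoint w s (frameX w P) (frameY w s P) = P := by
  ext i
  fin_cases i
  · simp [frameX, framePoint]; field_simp
  · simp [frameX, frameY, framePoint]

lemma mem_frameConic_framePoint (hw : w ≠ 0) (A B C κ a b x y : ℝ) :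
    framePoint w s x y ∈ frameConic w s A B C κ a b ↔
      A * (x - a) ^ 2 + 2 * B * (x - a) * (y - b) + C * (y - b) ^ 2 = κ := by
  simp only [frameConic, Set.mem_ofPred_eq, frameX_framePoint hw, frameY_framePoint hw]

/-- The trace of a positive definite form in the frame `(w, s), (0, 1)` is positive. -/
lemma frame_trace_pos (hw : w ≠ 0) {A B C : ℝ} (hC : 0 < C) (hD : 0 < A * C - B ^ 2) :
    0 < A - 2 * B * s + C * (s ^ 2 + w ^ 2) := by
  have : C * (A - 2 * B * s + C * (s ^ 2 + w ^ 2))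
      = (A * C - B ^ 2) + (B - C * s) ^ 2 + (C * w) ^ 2 := by ring
  have : 0 < C * (A - 2 * B * s + C * (s ^ 2 + w ^ 2)) := by rw [this]; positivity
  exact pos_of_mul_pos_right this hC.le

lemma frameRatio_le (hw : w ≠ 0) {A B C : ℝ} (hC : 0 < C) (hD : 0 < A * C - B ^ 2) :
    frameRatio w s A B C ≤ 1 / 4 := by
  have hT := frame_trace_pos (s := s) hw hC hD
  rw [frameRatio, div_le_div_iff₀ (by positivity) (by norm_num)]
  have hw2 : 0 < w ^ 2 := by positivity
  nlinarith [sq_nonneg (A - 2 * B * s + C * (s ^ 2 + w ^ 2) - 2 * C * w ^ 2),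
    sq_nonneg (w * (B - C * s))]

lemma isEllipse_frameConic (hw : w ≠ 0) {A B C κ : ℝ} (hC : 0 < C)
    (hD : 0 < A * C - B ^ 2) (hκ : 0 < κ) (a b : ℝ) :
    IsEllipseOfEccentricity (frameConic w s A B C κ a b) (eccOfRatio (frameRatio w s A B C)) := by
  have hw2 : 0 < w ^ 2 := by positivity
  have hD' : (A - 2 * B * s + C * s ^ 2) / w ^ 2 * C - ((B - C * s) / w) ^ 2
      = (A * C - B ^ 2) / w ^ 2 := by
    field_simp
    ring
  have hA' : 0 < (A - 2 * B * s + C * s ^ 2) / w ^ 2 := by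
    have : C * (A - 2 * B * s + C * s ^ 2) = (A * C - B ^ 2) + (B - C * s) ^ 2 := by ring
    have : 0 < C * (A - 2 * B * s + C * s ^ 2) := by rw [this]; positivity
    exact div_pos (pos_of_mul_pos_right this hC.le) hw2
  have h := isEllipse_of_form hA' (by rw [hD']; positivity) hκ (w * a) (b + s * a)
  convert h using 1
  · ext P
    simp only [frameConic, frameX, frameY, Set.mem_ofPred_eq]
    refine Eq.congr ?_ rfl
    field_simp
    ring
  · rw [hD', frameRatio]
    congr 1
    have hT := frame_trace_pos (s := s) hw hC hD
    have e : (A - 2 * B * s + C * s ^ 2) / w ^ 2 + C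
        = (A - 2 * B * s + C * (s ^ 2 + w ^ 2)) / w ^ 2 := by
      field_simp
      ring
    rw [e]
    field_simp

lemma exists_frameConic_of_isEllipse (hw : w ≠ 0) {S : Set Plane} {e : ℝ}
    (h : IsEllipseOfEccentricity S e) :
    ∃ A B C a b : ℝ, 0 < A ∧ 0 < C ∧ 0 < A * C - B ^ 2 ∧
      S = frameConic w s A B C (A * C - B ^ 2) a b ∧ e = eccOfRatio (frameRatio w s A B C) := by
  obtain ⟨A, B, C, a, b, hA, hC, hD, rfl, rfl⟩ := exists_form_of_isEllipse h
  have hw2 : 0 < w ^ 2 := by positivity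
  have hD' : (A * w ^ 2 + 2 * B * w * s + C * s ^ 2) / w ^ 2 * (C / w ^ 2)
      - ((B * w + C * s) / w ^ 2) ^ 2 = (A * C - B ^ 2) / w ^ 2 := by
    field_simp
    ring
  refine ⟨(A * w ^ 2 + 2 * B * w * s + C * s ^ 2) / w ^ 2, (B * w + C * s) / w ^ 2, C / w ^ 2,
    a / w, b - s * (a / w), ?_, by positivity, by rw [hD']; positivity, ?_, ?_⟩
  · have : C * (A * w ^ 2 + 2 * B * w * s + C * s ^ 2)
        = (A * C - B ^ 2) * w ^ 2 + (B * w + C * s) ^ 2 := by ring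
    have : 0 < C * (A * w ^ 2 + 2 * B * w * s + C * s ^ 2) := by rw [this]; positivity
    exact div_pos (pos_of_mul_pos_right this hC.le) hw2
  · rw [hD']
    ext P
    simp only [frameConic, frameX, frameY, Set.mem_ofPred_eq]
    rw [eq_div_iff hw2.ne']
    refine Eq.congr ?_ rfl
    field_simp
    ring
  · rw [frameRatio, hD']
    congr 1
    have e : (A * w ^ 2 + 2 * B * w * s + C * s ^ 2) / w ^ 2 - 2 * ((B * w + C * s) / w ^ 2) * s
        + C / w ^ 2 * (s ^ 2 + w ^ 2) = A + C := by
      field_simp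
      ring
    rw [e]
    field_simp

end Frame

/-! ### The family of trapezoids -/

/-- The trapezoid with vertices `(0, 0)`, `(w, s)`, `(w, s + t)`, `(0, 1)`: the image of `trap t`
under the linear map taking the standard basis to `(w, s), (0, 1)`. -/
noncomputable def trapW (t w s : ℝ) : Fin 4 → Plane :=
  ![framePoint w s 0 0, framePoint w s 1 0, framePoint w s 1 t, framePoint w s 0 1]

lemma trap_eq_trapW (t : ℝ) : trap t = trapW t 1 0 := by
  simp [trap, trapW, framePoint]

lemma isTrapezoid_trapW {t w s : ℝ} (ht : 0 < t) (ht1 : t ≠ 1) (hw : 0 < w) :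
    IsTrapezoid (trapW t w s) := by
  have hwt : 0 < w * t := by positivity
  refine ⟨Or.inl fun i => ?_, Or.inr ⟨?_, ?_⟩⟩
  · fin_cases i <;> simp [trapW, framePoint, cross] <;> linarith
  · simp [trapW, framePoint, cross]
  · intro h
    simp [trapW, framePoint, cross] at h
    have : w * (t - 1) = 0 := by linarith
    rcases mul_eq_zero.1 this with h | h
    · exact hw.ne' h
    · exact ht1 (by linarith)

lemma isUniqueEllipseOfMinEccentricity_of_lt_or_eq {P : Set Plane → Prop} {S : Set Plane}
    {e : ℝ} (hP : P S)
    (he : IsEllipseOfEccentricity S e)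
    (h : ∀ S' e', P S' → IsEllipseOfEccentricity S' e' → e < e' ∨ e' = e ∧ S' = S) :
    IsUniqueEllipseOfMinEccentricity P S e := by
  refine ⟨hP, he, fun S' e' hS' he' => ?_⟩
  rcases h S' e' hS' he' with h | ⟨rfl, rfl⟩
  · exact ⟨h.le, fun h' => absurd h' h.ne'⟩
  · exact ⟨le_rfl, fun _ => rfl⟩

/-! ### Circumscribed ellipses -/

section Circumscribed

variable {t w s : ℝ}

lemma circumscribedAbout_trapW_iff (hw : w ≠ 0) {A B C κ a b : ℝ} :
    CircumscribedAbout (trapW t w s) (frameConic w s A B C κ a b) ↔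
      A * (0 - a) ^ 2 + 2 * B * (0 - a) * (0 - b) + C * (0 - b) ^ 2 = κ ∧
      A * (1 - a) ^ 2 + 2 * B * (1 - a) * (0 - b) + C * (0 - b) ^ 2 = κ ∧
      A * (1 - a) ^ 2 + 2 * B * (1 - a) * (t - b) + C * (t - b) ^ 2 = κ ∧
      A * (0 - a) ^ 2 + 2 * B * (0 - a) * (1 - b) + C * (1 - b) ^ 2 = κ := by
  simp only [CircumscribedAbout, Fin.forall_fin_succ, IsEmpty.forall_iff, and_true, trapW,
    ← mem_frameConic_framePoint (s := s) hw]
  rfl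

/-- The largest value of `det / trace²` over the ellipses circumscribed about `trapW t w s`. -/
noncomputable def circumRatio (t w s : ℝ) : ℝ :=
  w ^ 2 / (4 * (((t - 1) / 2 + s) ^ 2 + w ^ 2))

/-- In the pencil of conics through the vertices, with form `A x² - (t - 1) C x y + C y²`, the ratio
`det / trace²` is maximal for exactly one value of `A / C`. -/
lemma frameRatio_circum_lt (hw : w ≠ 0) {A C : ℝ} (hC : 0 < C)
    (hD : 0 < A * C - (-((t - 1) / 2) * C) ^ 2)
    (hA : A ≠ ((t - 1) ^ 2 / 4 + (((t - 1) / 2 + s) ^ 2 + w ^ 2)) * C) :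
    frameRatio w s A (-((t - 1) / 2) * C) C < circumRatio t w s := by
  have hT := frame_trace_pos (s := s) hw hC hD
  have hw2 : 0 < w ^ 2 := by positivity
  rw [frameRatio, circumRatio, div_lt_div_iff₀ (by positivity) (by positivity)]
  have h : 0 < (A - ((t - 1) ^ 2 / 4 + (((t - 1) / 2 + s) ^ 2 + w ^ 2)) * C) ^ 2 :=
    sq_pos_of_ne_zero (sub_ne_zero.2 hA)
  linear_combination w ^ 2 * h

theorem exists_min_circumscribed (ht : t ≠ 0) (hw : w ≠ 0) :
    ∃ E_O : Set Plane, IsUniqueEllipseOfMinEccentricity (CircumscribedAbout (trapW t w s)) E_O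
      (eccOfRatio (circumRatio t w s)) := by
  set m := t - 1 with hm
  set K := (m / 2 + s) ^ 2 + w ^ 2 with hK
  have hK0 : 0 < K := by positivity
  set R := m ^ 2 / 4 + K with hR
  -- `R` is the optimal value of `A / C`, and `(a, b)` the centre: the conic in question is
  -- `R x² - m x y + y² - R x - y = 0`, whose gradient vanishes there
  set a := (R + m / 2) / (2 * K) with ha
  set b := (1 + m * a) / 2 with hb
  have ha' : 2 * K * a = R + m / 2 := by rw [ha]; field_simp
  have hκ : R * a ^ 2 - m * a * b + b ^ 2 = K * a ^ 2 + 1 / 4 := by rw [hR, hb]; ring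
  have hκ0 : 0 < R * a ^ 2 - m * a * b + b ^ 2 := by rw [hκ]; positivity
  have hD : 0 < R * 1 - (-(m / 2)) ^ 2 := by
    have : R * 1 - (-(m / 2)) ^ 2 = K := by rw [hR]; ring
    rwa [this]
  have hratio : frameRatio w s R (-(m / 2)) 1 = circumRatio t w s := by
    have e1 : R * 1 - (-(m / 2)) ^ 2 = K := by rw [hR]; ring
    have e2 : R - 2 * (-(m / 2)) * s + 1 * (s ^ 2 + w ^ 2) = 2 * K := by rw [hR, hK]; ring
    rw [frameRatio, circumRatio, e1, e2, ← hK]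
    field_simp
    ring
  have hcl : circumRatio t w s ≤ 1 / 4 := hratio ▸ frameRatio_le hw one_pos hD
  refine ⟨frameConic w s R (-(m / 2)) 1 (R * a ^ 2 - m * a * b + b ^ 2) a b,
    isUniqueEllipseOfMinEccentricity_of_lt_or_eq ?_
      (hratio ▸ isEllipse_frameConic hw one_pos hD hκ0 a b) ?_⟩
  · rw [circumscribedAbout_trapW_iff hw]
    have h2 : R * (1 - 2 * a) + m * b = 0 := by
      rw [hb]; linear_combination -ha' - 2 * a * hR
    refine ⟨by ring, by linear_combination h2, ?_, by rw [hb]; ring⟩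
    rw [hm] at h2 hb ⊢
    linear_combination h2 + t * (t - 1) * hb
  · intro S' e' hS' he'
    obtain ⟨A, B, C, a', b', hA, hC, hD', rfl, rfl⟩ :=
      exists_frameConic_of_isEllipse (s := s) hw he'
    rw [circumscribedAbout_trapW_iff hw] at hS'
    obtain ⟨h0, h1, h2, h3⟩ := hS'
    have hB : B = -(m / 2) * C := by
      apply mul_left_cancel₀ ht
      linear_combination (h2 - h1 - t * (h3 - h0)) / 2
    subst hB
    by_cases hAR : A = R * C
    · subst hAR
      right
      have hb' : b' = (1 + m * a') / 2 := by
        apply mul_left_cancel₀ hC.ne'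
        linear_combination (h0 - h3) / 2
      have ha'' : a' = a := by
        apply mul_left_cancel₀ (mul_pos (mul_pos two_pos hK0) hC).ne'
        subst hb'
        linear_combination (h0 - h1) - C * ha' + 2 * a' * C * hR
      have hb'' : b' = b := by rw [hb', ha'', hb]
      constructor
      · rw [← hratio, frameRatio, frameRatio]
        congr 1
        field_simp
      · ext P
        simp only [frameConic, Set.mem_ofPred_eq]
        rw [← h0, ha'', hb'']
        constructor
        · intro h
          apply mul_left_cancel₀ hC.ne'
          linear_combination h
        · intro h
          linear_combination C * h
    · exact Or.inl (eccOfRatio_strictAnti (frameRatio_circum_lt hw hC hD' hAR) hcl)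

end Circumscribed

/-! ### Tangent lines of an ellipse -/

section Tangency

variable {A B C a b n₀ n₁ d : ℝ}

/-- If a line meets the ellipse in a single point, it satisfies the tangency equation, in which the
inverse of the form is evaluated at the normal of the line. -/
lemma tangency_of_unique (hA : 0 < A) (hC : 0 < C) (hD : 0 < A * C - B ^ 2)
    (hn : n₀ ≠ 0 ∨ n₁ ≠ 0) {x y : ℝ}
    (h : A * (x - a) ^ 2 + 2 * B * (x - a) * (y - b) + C * (y - b) ^ 2 = A * C - B ^ 2)
    (hl : n₀ * x + n₁ * y = d)
    (huniq : ∀ x' y' : ℝ,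
      A * (x' - a) ^ 2 + 2 * B * (x' - a) * (y' - b) + C * (y' - b) ^ 2 = A * C - B ^ 2 →
      n₀ * x' + n₁ * y' = d → x' = x ∧ y' = y) :
    (d - n₀ * a - n₁ * b) ^ 2 = C * n₀ ^ 2 - 2 * B * n₀ * n₁ + A * n₁ ^ 2 := by
  -- `N` is the form at the direction `(-n₁, n₀)` of the line, `β` the polar form of that direction
  -- with `(x - a, y - b)`; the second point of intersection differs from the first by `-2β/N`
  set N := C * n₀ ^ 2 - 2 * B * n₀ * n₁ + A * n₁ ^ 2 with hN
  have hNpos : 0 < N := by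
    have h1 : C * N = (C * n₀ - B * n₁) ^ 2 + (A * C - B ^ 2) * n₁ ^ 2 := by rw [hN]; ring
    have h2 : A * N = (A * n₁ - B * n₀) ^ 2 + (A * C - B ^ 2) * n₀ ^ 2 := by rw [hN]; ring
    rcases hn with hn | hn
    · exact pos_of_mul_pos_right (h2 ▸ by positivity) hA.le
    · exact pos_of_mul_pos_right (h1 ▸ by positivity) hC.le
  set β := (B * n₀ - A * n₁) * (x - a) + (C * n₀ - B * n₁) * (y - b) with hβ
  set r := -2 * β / N with hr
  have hrN : r * N = -2 * β := by rw [hr]; field_simp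
  have h' := huniq (x - r * n₁) (y + r * n₀)
    (by linear_combination h + r * hrN + r ^ 2 * hN - 2 * r * hβ) (by linear_combination hl)
  have hβ0 : β = 0 := by
    have : r = 0 := by
      rcases hn with hn | hn
      · exact (mul_eq_zero.1 (by linarith [h'.2] : r * n₀ = 0)).resolve_right hn
      · exact (mul_eq_zero.1 (by linarith [h'.1] : r * n₁ = 0)).resolve_right hn
    rw [this] at hrN
    linarith
  rw [hβ] at hβ0
  apply mul_left_cancel₀ hD.ne'
  rw [← hl, hN]
  linear_combination (C * n₀ ^ 2 - 2 * B * n₀ * n₁ + A * n₁ ^ 2) * h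
    - ((B * n₀ - A * n₁) * (x - a) + (C * n₀ - B * n₁) * (y - b)) * hβ0

/-- The values of a linear functional on an ellipse are bounded by the inverse form. -/
lemma sq_le_of_mem_ellipse (hD : 0 < A * C - B ^ 2) {x y : ℝ}
    (h : A * (x - a) ^ 2 + 2 * B * (x - a) * (y - b) + C * (y - b) ^ 2 = A * C - B ^ 2) :
    (n₀ * (x - a) + n₁ * (y - b)) ^ 2 ≤ C * n₀ ^ 2 - 2 * B * n₀ * n₁ + A * n₁ ^ 2 := by
  refine le_of_mul_le_mul_left ?_ hD
  have := sq_nonneg ((B * n₀ - A * n₁) * (x - a) + (C * n₀ - B * n₁) * (y - b))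
  linear_combination this + (C * n₀ ^ 2 - 2 * B * n₀ * n₁ + A * n₁ ^ 2) * h

/-- A line satisfying the tangency equation meets the ellipse exactly at the point where the bound
of `sq_le_of_mem_ellipse` is attained. -/
lemma mem_ellipse_and_line_iff {δ : ℝ} (hδ : δ ≠ 0)
    (htan : δ ^ 2 = C * n₀ ^ 2 - 2 * B * n₀ * n₁ + A * n₁ ^ 2) {x y : ℝ} :
    A * (x - a) ^ 2 + 2 * B * (x - a) * (y - b) + C * (y - b) ^ 2 = A * C - B ^ 2 ∧
      n₀ * (x - a) + n₁ * (y - b) = δ ↔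
    x = a + (C * n₀ - B * n₁) / δ ∧ y = b + (A * n₁ - B * n₀) / δ := by
  constructor
  · rintro ⟨h, hl⟩
    have h0 : ((B * n₀ - A * n₁) * (x - a) + (C * n₀ - B * n₁) * (y - b)) ^ 2 = 0 := by
      rw [← hl] at htan
      linear_combination (-(A * C - B ^ 2)) * htan
        + (C * n₀ ^ 2 - 2 * B * n₀ * n₁ + A * n₁ ^ 2) * h
    have h0 := pow_eq_zero_iff two_ne_zero |>.1 h0
    constructor
    · rw [← sub_eq_iff_eq_add', eq_div_iff hδ]
      apply mul_right_cancel₀ hδ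
      linear_combination (x - a) * htan + (C * n₀ - B * n₁) * hl - n₁ * h0
    · rw [← sub_eq_iff_eq_add', eq_div_iff hδ]
      apply mul_right_cancel₀ hδ
      linear_combination (y - b) * htan + (A * n₁ - B * n₀) * hl + n₀ * h0
  · rintro ⟨rfl, rfl⟩
    rw [add_sub_cancel_left, add_sub_cancel_left]
    constructor
    · field_simp
      linear_combination (-(A * C - B ^ 2)) * htan
    · field_simp
      linear_combination -htan

end Tangency

/-! ### Sides of the trapezoid -/

lemma mem_line_framePoint_iff {w s : ℝ} (hw : w ≠ 0) {x₁ y₁ x₂ y₂ x y : ℝ}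
    (h : x₂ - x₁ ≠ 0 ∨ y₂ - y₁ ≠ 0) :
    framePoint w s x y ∈
        (affineSpan ℝ {framePoint w s x₁ y₁, framePoint w s x₂ y₂} : Set Plane) ↔
      (y₂ - y₁) * x + (x₁ - x₂) * y = (y₂ - y₁) * x₁ + (x₁ - x₂) * y₁ := by
  have key : ∀ r : ℝ, AffineMap.lineMap (framePoint w s x₁ y₁) (framePoint w s x₂ y₂) r
      = framePoint w s (x₁ + r * (x₂ - x₁)) (y₁ + r * (y₂ - y₁)) := by
    intro r
    ext i
    fin_cases i <;> simp [framePoint, AffineMap.lineMap_apply] <;> ring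
  rw [SetLike.mem_coe, mem_affineSpan_pair_iff_exists_lineMap_eq]
  simp only [key]
  constructor
  · rintro ⟨r, hr⟩
    have hx := congrArg (frameX w) hr
    have hy := congrArg (frameY w s) hr
    rw [frameX_framePoint hw, frameX_framePoint hw] at hx
    rw [frameY_framePoint hw, frameY_framePoint hw] at hy
    rw [← hx, ← hy]
    ring
  · intro hl
    rcases h with h | h
    · refine ⟨(x - x₁) / (x₂ - x₁), ?_⟩
      have h1 : (x - x₁) / (x₂ - x₁) * (x₂ - x₁) = x - x₁ := by field_simp
      have h2 : (x - x₁) / (x₂ - x₁) * (y₂ - y₁) = y - y₁ := by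
        field_simp
        linear_combination hl
      rw [h1, h2]
      congr 1 <;> ring
    · refine ⟨(y - y₁) / (y₂ - y₁), ?_⟩
      have h1 : (y - y₁) / (y₂ - y₁) * (y₂ - y₁) = y - y₁ := by field_simp
      have h2 : (y - y₁) / (y₂ - y₁) * (x₂ - x₁) = x - x₁ := by
        field_simp
        linear_combination -hl
      rw [h1, h2]
      congr 1 <;> ring

lemma framePoint_mem_segment {w s : ℝ} {x₁ y₁ x₂ y₂ r : ℝ} (h0 : 0 ≤ r) (h1 : r ≤ 1) :
    framePoint w s (x₁ + r * (x₂ - x₁)) (y₁ + r * (y₂ - y₁)) ∈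
      segment ℝ (framePoint w s x₁ y₁) (framePoint w s x₂ y₂) := by
  rw [segment_eq_image_lineMap]
  refine ⟨r, ⟨h0, h1⟩, ?_⟩
  ext i
  fin_cases i <;> simp [framePoint, AffineMap.lineMap_apply] <;> ring

/-- The condition of tangency to one side, in frame coordinates, yields the tangency equation. -/
lemma tangency_of_inter_eq_singleton {w s A B C a b x₁ y₁ x₂ y₂ : ℝ} (hw : w ≠ 0)
    (hA : 0 < A) (hC : 0 < C) (hD : 0 < A * C - B ^ 2) (h : x₂ - x₁ ≠ 0 ∨ y₂ - y₁ ≠ 0) {q : Plane}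
    (hq : frameConic w s A B C (A * C - B ^ 2) a b ∩
      (affineSpan ℝ {framePoint w s x₁ y₁, framePoint w s x₂ y₂} : Set Plane) = {q}) :
    ((y₂ - y₁) * (x₁ - a) + (x₁ - x₂) * (y₁ - b)) ^ 2
      = C * (y₂ - y₁) ^ 2 - 2 * B * (y₂ - y₁) * (x₁ - x₂) + A * (x₁ - x₂) ^ 2 := by
  have hq' : q ∈ frameConic w s A B C (A * C - B ^ 2) a b ∩
      (affineSpan ℝ {framePoint w s x₁ y₁, framePoint w s x₂ y₂} : Set Plane) := by
    rw [hq]; rfl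
  rw [← framePoint_frameX_frameY (s := s) hw q, Set.mem_inter_iff, mem_frameConic_framePoint hw,
    mem_line_framePoint_iff hw h] at hq'
  have := tangency_of_unique hA hC hD (n₀ := y₂ - y₁) (n₁ := x₁ - x₂)
    (by rcases h with h | h
        · right; contrapose! h; linarith
        · left; exact h) hq'.1 hq'.2 (by
      intro x' y' h1 h2
      have : framePoint w s x' y' ∈ ({q} : Set Plane) := by
        rw [← hq, Set.mem_inter_iff, mem_frameConic_framePoint hw, mem_line_framePoint_iff hw h]
        exact ⟨h1, h2⟩
      rw [Set.mem_singleton_iff] at this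
      rw [← this, frameX_framePoint hw, frameY_framePoint hw]
      exact ⟨rfl, rfl⟩)
  rw [← this]
  ring

/-- The tangency equation gives tangency to one side, provided that the point of contact, at the
parameter `r` of the side, lies between its end points. -/
lemma exists_inter_eq_singleton {w s A B C a b x₁ y₁ x₂ y₂ δ r : ℝ} (hw : w ≠ 0)
    (h : x₂ - x₁ ≠ 0 ∨ y₂ - y₁ ≠ 0)
    (hδ : δ = (y₂ - y₁) * (x₁ - a) + (x₁ - x₂) * (y₁ - b)) (hδ0 : δ ≠ 0)
    (htan : δ ^ 2 = C * (y₂ - y₁) ^ 2 - 2 * B * (y₂ - y₁) * (x₁ - x₂) + A * (x₁ - x₂) ^ 2)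
    (h0 : 0 ≤ r) (h1 : r ≤ 1)
    (hx : δ * (x₁ + r * (x₂ - x₁) - a) = C * (y₂ - y₁) - B * (x₁ - x₂))
    (hy : δ * (y₁ + r * (y₂ - y₁) - b) = A * (x₁ - x₂) - B * (y₂ - y₁)) :
    ∃ q ∈ segment ℝ (framePoint w s x₁ y₁) (framePoint w s x₂ y₂),
      frameConic w s A B C (A * C - B ^ 2) a b ∩
      (affineSpan ℝ {framePoint w s x₁ y₁, framePoint w s x₂ y₂} : Set Plane) = {q} := by
  refine ⟨_, framePoint_mem_segment h0 h1, ?_⟩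
  ext P
  obtain ⟨x, y, rfl⟩ : ∃ x y, framePoint w s x y = P := ⟨_, _, framePoint_frameX_frameY hw P⟩
  have e : (y₂ - y₁) * x + (x₁ - x₂) * y = (y₂ - y₁) * x₁ + (x₁ - x₂) * y₁ ↔
      (y₂ - y₁) * (x - a) + (x₁ - x₂) * (y - b) = δ := by
    rw [hδ]
    constructor <;> intro h <;> linear_combination h
  rw [Set.mem_inter_iff, mem_frameConic_framePoint hw, mem_line_framePoint_iff hw h, e,
    mem_ellipse_and_line_iff hδ0 htan, Set.mem_singleton_iff, ← hx, ← hy,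
    mul_div_cancel_left₀ _ hδ0, mul_div_cancel_left₀ _ hδ0]
  simp only [add_sub_cancel]
  constructor
  · rintro ⟨rfl, rfl⟩
    rfl
  · intro h
    have h1 := congrArg (frameX w) h
    have h2 := congrArg (frameY w s) h
    rw [frameX_framePoint hw, frameX_framePoint hw] at h1
    rw [frameY_framePoint hw, frameY_framePoint hw] at h2
    exact ⟨h1, h2⟩

lemma framePoint_mem_convexHull_trapW {t w s x y : ℝ} (ht : 0 < t) (hx0 : 0 ≤ x) (hx1 : x ≤ 1)
    (hy0 : 0 ≤ y) (hy1 : y ≤ 1 + (t - 1) * x) :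
    framePoint w s x y ∈ convexHull ℝ (Set.range (trapW t w s)) := by
  have hpos : 0 < 1 + (t - 1) * x := by
    rcases hx1.eq_or_lt with rfl | h
    · linarith
    · nlinarith
  -- `y` divides the vertical chord through `x` in the ratio `r`
  set r := y / (1 + (t - 1) * x) with hr
  have hr0 : 0 ≤ r := by positivity
  have hr1 : r ≤ 1 := by rw [hr, div_le_one hpos]; exact hy1
  have hy : y = r * (1 + (t - 1) * x) := by rw [hr]; field_simp
  have hV : ∀ i, trapW t w s i ∈ convexHull ℝ (Set.range (trapW t w s)) :=
    fun i => subset_convexHull _ _ ⟨i, rfl⟩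
  have hc := convex_convexHull ℝ (Set.range (trapW t w s))
  have hbot := hc (hV 0) (hV 1) (sub_nonneg.2 hx1) hx0 (by ring)
  have htop := hc (hV 3) (hV 2) (sub_nonneg.2 hx1) hx0 (by ring)
  have := hc hbot htop (sub_nonneg.2 hr1) hr0 (by ring)
  convert this using 1
  ext i
  fin_cases i <;> simp [framePoint, trapW, hy] <;> ring

/-! ### Inscribed ellipses -/

/-- The ratio `det / trace²` for the ellipse inscribed in `trapW t w s` that touches the side
`x = 1` at the fraction `z` of its length. In frame coordinates its centre is
`(1 / 2, (1 + (t - 1) z) / 2)`. -/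
noncomputable def inRatio (t w s z : ℝ) : ℝ :=
  frameRatio w s (((1 + (t - 1) * z) / 2) ^ 2) ((1 - 2 * z - (t - 1) * z) / 4) (1 / 4)

/-- The inscribed ellipse that touches the side `x = 1` at the fraction `z` of its length. -/
def inEllipse (t w s z : ℝ) : Set Plane :=
  frameConic w s (((1 + (t - 1) * z) / 2) ^ 2) ((1 - 2 * z - (t - 1) * z) / 4) (1 / 4)
    (((1 + (t - 1) * z) / 2) ^ 2 * (1 / 4) - ((1 - 2 * z - (t - 1) * z) / 4) ^ 2)
    (1 / 2) ((1 + (t - 1) * z) / 2)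

section Inscribed

variable {t w s : ℝ}

lemma inEllipse_det (t z : ℝ) :
    ((1 + (t - 1) * z) / 2) ^ 2 * (1 / 4) - ((1 - 2 * z - (t - 1) * z) / 4) ^ 2
      = t * (z * (1 - z)) / 4 := by
  ring

lemma chord_pos (ht : 0 < t) {z : ℝ} (h0 : 0 < z) (h1 : z < 1) : 0 < 1 + (t - 1) * z := by
  nlinarith [mul_pos ht h0]

lemma inEllipse_det_pos (ht : 0 < t) {z : ℝ} (h0 : 0 < z) (h1 : z < 1) :
    0 < ((1 + (t - 1) * z) / 2) ^ 2 * (1 / 4) - ((1 - 2 * z - (t - 1) * z) / 4) ^ 2 := by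
  have := sub_pos.2 h1
  rw [inEllipse_det]
  positivity

lemma inscribedIn_inEllipse (ht : 0 < t) (hw : w ≠ 0) {z : ℝ} (h0 : 0 < z) (h1 : z < 1) :
    InscribedIn (trapW t w s) (inEllipse t w s z) := by
  have hD := inEllipse_det_pos ht h0 h1
  have hb := chord_pos ht h0 h1
  have hb' := chord_pos ht (z := 1 - z) (by linarith) (by linarith)
  have h1z : 0 < 1 - z := by linarith
  constructor
  · intro P hP
    obtain ⟨x, y, rfl⟩ : ∃ x y, framePoint w s x y = P := ⟨_, _, framePoint_frameX_frameY hw P⟩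
    rw [inEllipse, mem_frameConic_framePoint hw] at hP
    have hx := sq_le_of_mem_ellipse (n₀ := 1) (n₁ := 0) hD hP
    have hy := sq_le_of_mem_ellipse (n₀ := 0) (n₁ := 1) hD hP
    have hl := sq_le_of_mem_ellipse (n₀ := -(t - 1)) (n₁ := 1) hD hP
    have hx' := abs_le_of_sq_le_sq' (a := x - 1 / 2) (b := 1 / 2) (by linear_combination hx)
      (by norm_num)
    have hy' := abs_le_of_sq_le_sq' (a := y - (1 + (t - 1) * z) / 2) (b := (1 + (t - 1) * z) / 2)
      (by linear_combination hy) (by positivity)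
    have hl' := abs_le_of_sq_le_sq' (b := (1 + (t - 1) * (1 - z)) / 2)
      (a := -(t - 1) * (x - 1 / 2) + (y - (1 + (t - 1) * z) / 2))
      (by linear_combination hl) (by positivity)
    exact framePoint_mem_convexHull_trapW ht (by linarith [hx'.1]) (by linarith [hx'.2])
      (by linarith [hy'.1]) (by linarith [hl'.2])
  · rw [Fin.forall_fin_succ, Fin.forall_fin_succ, Fin.forall_fin_succ, Fin.forall_fin_succ]
    refine ⟨?_, ?_, ?_, ?_, fun i => i.elim0⟩
    · exact exists_inter_eq_singleton (x₁ := 0) (y₁ := 0) (x₂ := 1) (y₂ := 0)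
        (δ := (1 + (t - 1) * z) / 2) (r := (1 - z) / (1 + (t - 1) * z)) hw (by norm_num)
        (by ring) (by positivity) (by ring) (by positivity)
        (by rw [div_le_one hb]; nlinarith [mul_pos ht h0]) (by field_simp; ring) (by ring)
    · exact exists_inter_eq_singleton (x₁ := 1) (y₁ := 0) (x₂ := 1) (y₂ := t)
        (δ := t / 2) (r := z) hw (by right; simpa using ht.ne')
        (by ring) (by positivity) (by ring) h0.le h1.le (by ring) (by ring)
    · exact exists_inter_eq_singleton (x₁ := 1) (y₁ := t) (x₂ := 0) (y₂ := 1)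
        (δ := (1 + (t - 1) * (1 - z)) / 2) (r := t * (1 - z) / (1 + (t - 1) * (1 - z))) hw
        (by norm_num) (by ring) (by positivity) (by ring) (by positivity)
        (by rw [div_le_one hb']; nlinarith) (by field_simp; ring) (by field_simp; ring)
    · exact exists_inter_eq_singleton (x₁ := 0) (y₁ := 1) (x₂ := 0) (y₂ := 0)
        (δ := 1 / 2) (r := z) hw (by norm_num)
        (by ring) (by norm_num) (by ring) h0.le h1.le (by ring) (by ring)

/-- The four tangency equations leave a one-parameter family. -/
lemma eq_inEllipse_of_inscribedIn (ht : 0 < t) (ht1 : t ≠ 1) (hw : w ≠ 0) {A B C a b : ℝ}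
    (hA : 0 < A) (hC : 0 < C) (hD : 0 < A * C - B ^ 2)
    (h : InscribedIn (trapW t w s) (frameConic w s A B C (A * C - B ^ 2) a b)) :
    ∃ z, 0 < z ∧ z < 1 ∧ frameConic w s A B C (A * C - B ^ 2) a b = inEllipse t w s z ∧
      frameRatio w s A B C = inRatio t w s z := by
  obtain ⟨q₀, -, h₀⟩ := h.2 0
  obtain ⟨q₁, -, h₁⟩ := h.2 1
  obtain ⟨q₂, -, h₂⟩ := h.2 2
  obtain ⟨q₃, -, h₃⟩ := h.2 3
  replace h₀ := tangency_of_inter_eq_singleton (x₁ := 0) (y₁ := 0) (x₂ := 1) (y₂ := 0) hw hA hC hD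
    (by norm_num) h₀
  replace h₁ := tangency_of_inter_eq_singleton (x₁ := 1) (y₁ := 0) (x₂ := 1) (y₂ := t) hw hA hC hD
    (by right; simpa using ht.ne') h₁
  replace h₂ := tangency_of_inter_eq_singleton (x₁ := 1) (y₁ := t) (x₂ := 0) (y₂ := 1) hw hA hC hD
    (by norm_num) h₂
  replace h₃ := tangency_of_inter_eq_singleton (x₁ := 0) (y₁ := 1) (x₂ := 0) (y₂ := 0) hw hA hC hD
    (by norm_num) h₃
  have hAb : A = b ^ 2 := by linear_combination -h₀
  have hCa : C = a ^ 2 := by linear_combination -h₃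
  have ha : a = 1 / 2 := by
    apply mul_left_cancel₀ (pow_pos ht 2).ne'
    linear_combination (-h₁ - t ^ 2 * hCa) / 2
  subst hAb hCa ha
  have hm : t - 1 ≠ 0 := sub_ne_zero.2 ht1
  obtain ⟨z, rfl⟩ : ∃ z, b = (1 + (t - 1) * z) / 2 :=
    ⟨(2 * b - 1) / (t - 1), by field_simp; ring⟩
  have hB : B = (1 - 2 * z - (t - 1) * z) / 4 := by
    apply mul_left_cancel₀ hm
    linear_combination -h₂ / 2
  subst hB
  have hz : 0 < z * (1 - z) := by
    have : t * (z * (1 - z)) = 4 * (((1 + (t - 1) * z) / 2) ^ 2 * (1 / 2) ^ 2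
      - ((1 - 2 * z - (t - 1) * z) / 4) ^ 2) := by ring
    exact pos_of_mul_pos_right (this ▸ by positivity) ht.le
  have hz0 : 0 < z := by
    by_contra hz0
    nlinarith
  refine ⟨z, hz0, by linarith [pos_of_mul_pos_right hz hz0.le], ?_, ?_⟩ <;>
    norm_num [inEllipse, inRatio]

/-- A strict maximiser of `det / trace²` in the family of inscribed ellipses gives the unique
inscribed ellipse of minimal eccentricity. -/
theorem exists_min_inscribed (ht : 0 < t) (ht1 : t ≠ 1) (hw : w ≠ 0) {z₀ : ℝ} (h0 : 0 < z₀)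
    (h1 : z₀ < 1)
    (hmax : ∀ z, 0 < z → z < 1 → z ≠ z₀ → inRatio t w s z < inRatio t w s z₀) :
    ∃ E_I : Set Plane, IsUniqueEllipseOfMinEccentricity (InscribedIn (trapW t w s)) E_I
      (eccOfRatio (inRatio t w s z₀)) := by
  have hD := inEllipse_det_pos ht h0 h1
  refine ⟨inEllipse t w s z₀, isUniqueEllipseOfMinEccentricity_of_lt_or_eq
    (inscribedIn_inEllipse ht hw h0 h1)
    (isEllipse_frameConic hw (by norm_num) hD hD _ _) ?_⟩
  intro S' e' hS' he'
  obtain ⟨A, B, C, a', b', hA, hC, hD', rfl, rfl⟩ :=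
    exists_frameConic_of_isEllipse (s := s) hw he'
  obtain ⟨z, hz0, hz1, hS, hr⟩ := eq_inEllipse_of_inscribedIn ht ht1 hw hA hC hD' hS'
  rw [hS, hr]
  rcases eq_or_ne z z₀ with rfl | hz
  · exact Or.inr ⟨rfl, rfl⟩
  · exact Or.inl (eccOfRatio_strictAnti (hmax z hz0 hz1 hz) (frameRatio_le hw (by norm_num) hD))

end Inscribed

/-! ### The optimal inscribed ellipse of `trap t` -/

section Optimum

variable {t : ℝ}

lemma inRatio_one_zero (t z : ℝ) :
    inRatio t 1 0 z = 4 * t * (z * (1 - z)) / (1 + (1 + (t - 1) * z) ^ 2) ^ 2 := by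
  have : (1 : ℝ) + (1 + (t - 1) * z) ^ 2 ≠ 0 := by positivity
  rw [inRatio, frameRatio, inEllipse_det]
  have e : ((1 + (t - 1) * z) / 2) ^ 2 - 2 * ((1 - 2 * z - (t - 1) * z) / 4) * 0
      + 1 / 4 * (0 ^ 2 + 1 ^ 2) = (1 + (1 + (t - 1) * z) ^ 2) / 4 := by ring
  rw [e]
  field_simp

/-- In terms of the point of contact `z`, the cubic `cubicC t` becomes `t - 1` times the numerator
of the derivative of the ratio `inRatio t 1 0`. -/
lemma cubicC_half (t z : ℝ) : cubicC t ((1 + (t - 1) * z) / 2)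
    = (t - 1) * (2 * (t - 1) ^ 2 * z ^ 3 - 3 * (t - 1) ^ 2 * z ^ 2 - (2 * (t - 1) + 4) * z + 2) := by
  unfold cubicC
  ring

/-- Two roots of the cubic in `(0, 1)` coincide: the third root of a cubic with positive leading
coefficient, positive at `0` and negative at `1`, would have to be both negative and larger
than `1`. -/
lemma cubicC_root_unique (ht1 : t ≠ 1) {z₁ z₂ : ℝ} (h1 : 0 < z₁) (h1' : z₁ < 1)
    (h2 : 0 < z₂) (h2' : z₂ < 1) (hc1 : cubicC t ((1 + (t - 1) * z₁) / 2) = 0)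
    (hc2 : cubicC t ((1 + (t - 1) * z₂) / 2) = 0) : z₁ = z₂ := by
  by_contra hne
  have hm : t - 1 ≠ 0 := sub_ne_zero.2 ht1
  rw [cubicC_half, mul_eq_zero, or_iff_right hm] at hc1 hc2
  set m := t - 1
  have hsub : z₁ - z₂ ≠ 0 := sub_ne_zero.2 hne
  -- the cubic is `(z - z₁) (z - z₂) (2 m² z - ρ)`
  obtain ⟨ρ, hρ⟩ : ∃ ρ, ρ = 3 * m ^ 2 - 2 * m ^ 2 * (z₁ + z₂) := ⟨_, rfl⟩
  have hE : 2 + ρ * (z₁ * z₂) = 0 := by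
    apply mul_left_cancel₀ hsub
    rw [hρ]
    linear_combination z₁ * hc2 - z₂ * hc1
  have hdd : 2 * m ^ 2 * (z₁ ^ 2 + z₁ * z₂ + z₂ ^ 2) - 3 * m ^ 2 * (z₁ + z₂) - (2 * m + 4) = 0 := by
    apply mul_left_cancel₀ hsub
    linear_combination hc1 - hc2
  have hone : (1 - z₁) * (1 - z₂) * (2 * m ^ 2 - ρ) = -((m + 1) ^ 2 + 1) := by
    rw [hρ] at hE ⊢
    linear_combination -hdd - hE
  have hρ0 : ρ < 0 := by
    by_contra h
    nlinarith [mul_nonneg (not_lt.1 h) (mul_pos h1 h2).le]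
  have : 0 < (1 - z₁) * (1 - z₂) * (2 * m ^ 2 - ρ) := by
    have := sub_pos.2 h1'
    have := sub_pos.2 h2'
    have : 0 < 2 * m ^ 2 - ρ := by nlinarith [sq_nonneg m]
    positivity
  nlinarith [sq_nonneg (m + 1)]

lemma hasDerivAt_inRatio (t z : ℝ) : HasDerivAt (inRatio t 1 0)
    (4 * t * (2 * (t - 1) ^ 2 * z ^ 3 - 3 * (t - 1) ^ 2 * z ^ 2 - (2 * (t - 1) + 4) * z + 2)
      / (1 + (1 + (t - 1) * z) ^ 2) ^ 3) z := by
  have hN : (1 : ℝ) + (1 + (t - 1) * z) ^ 2 ≠ 0 := by positivity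
  have h1 : HasDerivAt (fun z => 4 * t * (z * (1 - z))) (4 * t * (1 * (1 - z) + z * (0 - 1))) z :=
    (((hasDerivAt_id z).mul ((hasDerivAt_const z 1).sub (hasDerivAt_id z)))).const_mul _
  have h2 : HasDerivAt (fun z => (1 + (1 + (t - 1) * z) ^ 2) ^ 2)
      (2 * (1 + (1 + (t - 1) * z) ^ 2) ^ 1 * (2 * (1 + (t - 1) * z) ^ 1 * ((t - 1) * 1))) z :=
    ((((((hasDerivAt_id z).const_mul (t - 1)).const_add 1).pow 2).const_add 1).pow 2)
  have h := h1.div h2 (by positivity)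
  have e : inRatio t 1 0 = (fun z => 4 * t * (z * (1 - z))) /
      (fun z => (1 + (1 + (t - 1) * z) ^ 2) ^ 2) := by
    ext z
    simp [inRatio_one_zero]
  rw [e]
  refine h.congr_deriv ?_
  field_simp
  ring

/-- The optimal point of contact for `trap t` exists, is a root of the cubic, and is a strict
maximiser. -/
lemma exists_isMax_inRatio (ht : 0 < t) (ht1 : t ≠ 1) :
    ∃ z₀, 0 < z₀ ∧ z₀ < 1 ∧ cubicC t ((1 + (t - 1) * z₀) / 2) = 0 ∧
      ∀ z, 0 < z → z < 1 → z ≠ z₀ → inRatio t 1 0 z < inRatio t 1 0 z₀ := by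
  have hcont : Continuous (inRatio t 1 0) :=
    continuous_iff_continuousAt.2 fun z => (hasDerivAt_inRatio t z).continuousAt
  have hpos : ∀ z, 0 < z → z < 1 → 0 < inRatio t 1 0 z := by
    intro z h0 h1
    have := sub_pos.2 h1
    rw [inRatio_one_zero]
    positivity
  -- every maximiser in `(0, 1)` is a critical point, hence a root of the cubic
  have hroot : ∀ z, 0 < z → z < 1 → IsMaxOn (inRatio t 1 0) (Set.Icc 0 1) z →
      cubicC t ((1 + (t - 1) * z) / 2) = 0 := by
    intro z h0 h1 hz
    have h := (hz.isLocalMax (Icc_mem_nhds h0 h1)).hasDerivAt_eq_zero (hasDerivAt_inRatio t z)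
    rw [div_eq_zero_iff, or_iff_left (by positivity), mul_eq_zero, or_iff_right (by positivity)] at h
    rw [cubicC_half, h, mul_zero]
  obtain ⟨z₀, hz₀, hmax⟩ := isCompact_Icc.exists_isMaxOn (Set.nonempty_Icc.2 zero_le_one)
    hcont.continuousOn
  have hpos₀ : 0 < inRatio t 1 0 z₀ :=
    (hpos (1 / 2) (by norm_num) (by norm_num)).trans_le (hmax ⟨by norm_num, by norm_num⟩)
  have h0 : 0 < z₀ := by
    refine hz₀.1.lt_of_ne ?_
    rintro rfl
    simp [inRatio_one_zero] at hpos₀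
  have h1 : z₀ < 1 := by
    refine hz₀.2.lt_of_ne ?_
    rintro rfl
    simp [inRatio_one_zero] at hpos₀
  refine ⟨z₀, h0, h1, hroot z₀ h0 h1 hmax, fun z hz0 hz1 hne => ?_⟩
  refine (hmax ⟨hz0.le, hz1.le⟩).lt_of_ne fun heq => hne ?_
  refine cubicC_root_unique ht1 hz0 hz1 h0 h1 (hroot z hz0 hz1 fun x hx => ?_)
    (hroot z₀ h0 h1 hmax)
  exact (hmax hx).trans_eq heq.symm

lemma half_mem_Ioo_iff (ht1 : t ≠ 1) (z : ℝ) :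
    (1 + (t - 1) * z) / 2 ∈ Set.Ioo (min (1 / 2) (t / 2)) (max (1 / 2) (t / 2)) ↔
      0 < z ∧ z < 1 := by
  rcases ht1.lt_or_gt with h | h
  · rw [min_eq_right (by linarith), max_eq_left (by linarith), Set.mem_Ioo]
    constructor
    · rintro ⟨h1, h2⟩
      constructor <;> by_contra! h3 <;> nlinarith
    · rintro ⟨h1, h2⟩
      constructor <;> nlinarith
  · rw [min_eq_left (by linarith), max_eq_right (by linarith), Set.mem_Ioo]
    constructor
    · rintro ⟨h1, h2⟩
      constructor <;> by_contra! h3 <;> nlinarith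
    · rintro ⟨h1, h2⟩
      constructor <;> nlinarith

lemma eccOfRatio_circumRatio (ht1 : t ≠ 1) : eccOfRatio (circumRatio t 1 0)
    = √(2 * |t - 1| / (√((t - 1) ^ 2 + 4) + |t - 1|)) := by
  have hm : 0 < |t - 1| := abs_pos.2 (sub_ne_zero.2 ht1)
  have h4 : 0 < (t - 1) ^ 2 + 4 := by positivity
  have h : 1 - 4 * circumRatio t 1 0 = (|t - 1| / √((t - 1) ^ 2 + 4)) ^ 2 := by
    rw [div_pow, sq_abs, Real.sq_sqrt h4.le, circumRatio]
    field_simp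
    ring
  rw [eccOfRatio, h, Real.sqrt_sq (by positivity)]
  congr 1
  field_simp

lemma eccOfRatio_inRatio (ht : 0 < t) (ht1 : t ≠ 1) {z : ℝ} (h0 : 0 < z) (h1 : z < 1) :
    eccOfRatio (inRatio t 1 0 z)
      = √(2 / (1 + √(1 - 16 * t * ratioE t ((1 + (t - 1) * z) / 2)))) := by
  have hm : t - 1 ≠ 0 := sub_ne_zero.2 ht1
  have hN : 0 < 1 + (1 + (t - 1) * z) ^ 2 := by positivity
  -- the inscribed ellipse is not a circle, as its centre is not at height `1 / 2`
  have hQ : 0 < (1 + (1 + (t - 1) * z) ^ 2) ^ 2 - 16 * t * (z * (1 - z)) := by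
    have h : 0 < ((t - 1) * z * (2 + (t - 1) * z)) ^ 2 + 4 * (1 - 2 * z - (t - 1) * z) ^ 2 := by
      have := chord_pos ht h0 h1
      have : 0 < 2 + (t - 1) * z := by linarith
      positivity
    -- up to a factor, `h` is the discriminant `(A - C)² + 4 B²` of the characteristic polynomial
    linear_combination h
  have hr : 1 - 4 * inRatio t 1 0 z
      = ((1 + (1 + (t - 1) * z) ^ 2) ^ 2 - 16 * t * (z * (1 - z)))
        / (1 + (1 + (t - 1) * z) ^ 2) ^ 2 := by
    rw [inRatio_one_zero]
    field_simp
    ring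
  have hpos : 0 < 1 - 4 * inRatio t 1 0 z := by rw [hr]; positivity
  have hE : 1 - 16 * t * ratioE t ((1 + (t - 1) * z) / 2) = (1 - 4 * inRatio t 1 0 z)⁻¹ := by
    have hden : 16 * (t - 1) ^ 2 * ((1 + (t - 1) * z) / 2) ^ 4
        + (8 + 8 * t ^ 2 + 48 * t) * ((1 + (t - 1) * z) / 2) ^ 2
        - 32 * t * (1 + t) * ((1 + (t - 1) * z) / 2) + 17 * t ^ 2 - 2 * t + 1
        = (t - 1) ^ 2 * ((1 + (1 + (t - 1) * z) ^ 2) ^ 2 - 16 * t * (z * (1 - z))) := by ring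
    have hnum : (2 * ((1 + (t - 1) * z) / 2) - 1) * (2 * ((1 + (t - 1) * z) / 2) - t)
        = -((t - 1) ^ 2 * (z * (1 - z))) := by ring
    rw [ratioE, hden, hnum, hr, inv_div]
    generalize hQ' : (1 + (1 + (t - 1) * z) ^ 2) ^ 2 - 16 * t * (z * (1 - z)) = Q at hQ
    field_simp
    linear_combination -hQ'
  rw [hE, eccOfRatio, Real.sqrt_inv]
  have := Real.sqrt_pos.2 hpos
  congr 1
  field_simp
  ring

end Optimum

/-! ### A bielliptic trapezoid -/

lemma isEllipse_sphere (c : Plane) {r : ℝ} (hr : 0 < r) :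
    IsEllipseOfEccentricity (Metric.sphere c r) 0 := by
  have h := isEllipse_of_form (A := 1) (B := 0) (C := 1) (κ := r ^ 2) one_pos (by norm_num)
    (by positivity) (c 0) (c 1)
  convert h using 1
  · ext P
    simp only [Set.mem_ofPred_eq, mem_sphere_iff_norm, EuclideanSpace.norm_eq, Fin.sum_univ_two,
      Real.sqrt_eq_iff_mul_self_eq_of_pos hr, PiLp.sub_apply, Real.norm_eq_abs, sq_abs]
    constructor <;> intro h <;> linear_combination -h
  · norm_num [eccOfRatio]

/-- A bielliptic quadrilateral of class `τ > 0` has no circumscribed circle. -/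
lemma IsBiellipticOfClass.not_isBicentric {V : Fin 4 → Plane} {τ : ℝ}
    (h : IsBiellipticOfClass V τ) (hτ : 0 < τ) : ¬ IsBicentric V := by
  rintro ⟨-, -, c, r, hr, hc⟩
  obtain ⟨-, -, E, -, -, -, hE⟩ := h
  exact (hE _ _ hc (isEllipse_sphere c hr)).1.not_gt hτ

/-- For `t = 7`, `s = -9 / 4`, `w² = 171 / 16`, the ratio of the inscribed ellipses is maximal at the
point of contact `5 / 12`, and there it equals the optimal circumscribed ratio `19 / 80`. -/
lemma isBiellipticOfClass_trapW :
    IsBiellipticOfClass (trapW 7 (√171 / 4) (-9 / 4)) (eccOfRatio (19 / 80)) := by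
  have hw : 0 < √171 / 4 := by positivity
  have hw2 : (√171 / 4) ^ 2 = 171 / 16 := by
    rw [div_pow, Real.sq_sqrt (by norm_num)]
    norm_num
  have hcirc : circumRatio 7 (√171 / 4) (-9 / 4) = 19 / 80 := by
    rw [circumRatio, hw2]
    norm_num
  have hin : ∀ z, inRatio 7 (√171 / 4) (-9 / 4) z
      = 171 / 16 * (7 * (z * (1 - z)) / 4) / (9 * z ^ 2 - 6 * z + 85 / 16) ^ 2 := by
    intro z
    rw [inRatio, frameRatio, inEllipse_det, hw2]
    congr 2
    ring
  have hin₀ : inRatio 7 (√171 / 4) (-9 / 4) (5 / 12) = 19 / 80 := by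
    rw [hin]
    norm_num
  refine ⟨(isTrapezoid_trapW (by norm_num) (by norm_num) hw).1, ?_⟩
  obtain ⟨E_O, hO⟩ := exists_min_circumscribed (t := 7) (s := -9 / 4) (by norm_num) hw.ne'
  obtain ⟨E_I, hI⟩ := exists_min_inscribed (t := 7) (s := -9 / 4) (z₀ := 5 / 12) (by norm_num)
    (by norm_num) hw.ne' (by norm_num) (by norm_num) (by
      intro z h0 h1 hne
      rw [hin₀, hin, div_lt_div_iff₀ (by nlinarith [sq_nonneg (3 * z - 1)]) (by norm_num)]
      -- the difference of the two sides has the double root `5 / 12`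
      have h := mul_pos (sq_pos_of_ne_zero (sub_ne_zero.2 hne))
        (by nlinarith [sq_nonneg (z - 1 / 4)] : 0 < 81 * z ^ 2 - 81 / 2 * z + 2601 / 16)
      linear_combination 19 * h)
  rw [hin₀] at hI
  rw [hcirc] at hO
  exact ⟨E_I, E_O, hI, hO⟩

theorem theorem5 :
    (∃ (V : Fin 4 → Plane) (τ : ℝ), 0 < τ ∧ τ < 1 ∧
      IsTrapezoid V ∧ IsBiellipticOfClass V τ ∧ ¬ IsBicentric V) ∧
    (∀ t : ℝ, 0 < t → t ≠ 1 →
      IsTrapezoid (trap t) ∧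
      (∃ E_O : Set Plane, IsUniqueEllipseOfMinEccentricity (CircumscribedAbout (trap t)) E_O
        √(2 * |t - 1| / (√((t - 1) ^ 2 + 4) + |t - 1|))) ∧
      (∃ k₀ ∈ Set.Ioo (min (1 / 2) (t / 2)) (max (1 / 2) (t / 2)),
        cubicC t k₀ = 0 ∧
        (∀ k ∈ Set.Ioo (min (1 / 2) (t / 2)) (max (1 / 2) (t / 2)), cubicC t k = 0 → k = k₀) ∧
        ∃ E_I : Set Plane, IsUniqueEllipseOfMinEccentricity (InscribedIn (trap t)) E_I
          √(2 / (1 + √(1 - 16 * t * ratioE t k₀))))) := by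
  constructor
  · have hτ : 0 < eccOfRatio (19 / 80) := by
      unfold eccOfRatio
      norm_num
      positivity
    have hτ1 : eccOfRatio (19 / 80) < 1 := by
      have h : eccOfRatio 0 = 1 := by norm_num [eccOfRatio]
      exact h ▸ eccOfRatio_strictAnti (by norm_num) (by norm_num)
    exact ⟨_, _, hτ, hτ1, isTrapezoid_trapW (by norm_num) (by norm_num) (by positivity),
      isBiellipticOfClass_trapW, isBiellipticOfClass_trapW.not_isBicentric hτ⟩
  · intro t ht ht1
    rw [trap_eq_trapW, ← eccOfRatio_circumRatio ht1]
    refine ⟨isTrapezoid_trapW ht ht1 one_pos, exists_min_circumscribed ht.ne' one_ne_zero, ?_⟩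
    obtain ⟨z₀, h0, h1, hc, hmax⟩ := exists_isMax_inRatio ht ht1
    refine ⟨(1 + (t - 1) * z₀) / 2, (half_mem_Ioo_iff ht1 z₀).2 ⟨h0, h1⟩, hc, ?_, ?_⟩
    · intro k hk hck
      obtain ⟨z, rfl⟩ : ∃ z, k = (1 + (t - 1) * z) / 2 :=
        ⟨(2 * k - 1) / (t - 1), by have := sub_ne_zero.2 ht1; field_simp; ring⟩
      obtain ⟨hz0, hz1⟩ := (half_mem_Ioo_iff ht1 z).1 hk
      rw [cubicC_root_unique ht1 hz0 hz1 h0 h1 hck hc]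
    · rw [← eccOfRatio_inRatio ht ht1 h0 h1]
      exact exists_min_inscribed ht ht1 one_ne_zero h0 h1 hmax
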